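/- Terms are first-order terms over a signature $\mathcal{F}$ (a set of function symbols, each with a fixed arity) and a countably infinite set $\mathcal{V}$ of variables; a term is ground if it contains no variables. A rewrite rule $\ell \to r$ over $\mathcal{F}$ is a pair of terms over $\mathcal{F}$ and $\mathcal{V}$ such that $\ell$ is not a variable and every variable of $r$ occurs in $\ell$. A term rewrite system (TRS) consists of a signature and a set of rewrite rules over it; its rewrite relation $\to$, on the terms over its signature and $\mathcal{V}$, is the closure of its rules under substitutions and contexts. It is confluent if, for all terms $s, t, u$ over its signature with $s \to^* t$ and $s \to^* u$, there is a term $w$ with $t \to^* w$ and $u \to^* w$. Let $\mathcal{R}_1$ and $\mathcal{R}_2$ be TRSs over signatures $\mathcal{F}_1$ and $\mathcal{F}_2$, where each symbol in $\mathcal{F}_1 \cap \mathcal{F}_2$ (a shared symbol) has the same arity in both. Let $\mathcal{R} = \mathcal{R}_1 \cup \mathcal{R}_2$, a TRS over the signature $\mathcal{F}_1 \cup \mathcal{F}_2$. A term over $\mathcal{F}_1 \cup \mathcal{F}_2$ and $\mathcal{V}$ is called quasi-ground if each of its subterms whose root is a shared symbol is ground. Theorem. Suppose that for every rule $\ell \to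 r$ in $\mathcal{R}$ the root of $\ell$ is not in $\mathcal{F}_1 \cap \mathcal{F}_2$, and both $\ell$ and $r$ are quasi-ground. If $\mathcal{R}_1$ and $\mathcal{R}_2$ are confluent, then $\mathcal{R}$ is confluent. -/

import Mathlib

/-!
First-order term rewriting. The function symbols, each with a fixed arity, are those of a
first-order language `L` (its relation symbols play no role); a signature is a set of them.
-/

namespace Rewriting

open FirstOrder FirstOrder.Language

universe u v w

variable {L : FirstOrder.Language.{u, v}} {V : Type w}

/-- Function symbols: pairs of an arity `n` and an `n`-ary function symbol of `L`. -/
abbrev Symbol (L : FirstOrder.Language.{u, v}) : Type u := Σ n, L.Functions n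

/-- The set of variables that occur in a term. -/
def vars : L.Term V → Set V
  | .var x => {x}
  | .func _ ts => ⋃ i, vars (ts i)

/-- The set of function symbols that occur in a term. -/
def funs : L.Term V → Set (Symbol L)
  | .var _ => ∅
  | .func (l := n) f ts => insert ⟨n, f⟩ (⋃ i, funs (ts i))

/-- The set of terms over the signature `F` and the variables `V`. -/
def termsOver (V : Type w) (F : Set (Symbol L)) : Set (L.Term V) :=
  {t | funs t ⊆ F}

/-- The set of ground terms over the signature `F`. -/
def groundTerms (V : Type w) (F : Set (Symbol L)) : Set (L.Term V) :=
  {t | t ∈ termsOver V F ∧ vars t = ∅}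

/-- The root of the term is a function symbol from `S` (so the term is not a variable). -/
def RootIn (S : Set (Symbol L)) : L.Term V → Prop
  | .var _ => False
  | .func (l := n) f _ => (⟨n, f⟩ : Symbol L) ∈ S

/-- `Subterm s t`: the term `s` is `t` itself or a proper subterm of `t`, that is, `s` is the
subterm of `t` at some position of `t`. -/
inductive Subterm : L.Term V → L.Term V → Prop
  | refl (t : L.Term V) : Subterm t t
  | arg {s : L.Term V} {n : ℕ} (f : L.Functions n) (ts : Fin n → L.Term V) (i : Fin n)
      (h : Subterm s (ts i)) : Subterm s (.func f ts)

/-- A rewrite rule over the signature `F`: a pair of terms over `F` whose left-hand side is not a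
variable and contains every variable of the right-hand side. -/
structure IsRule (F : Set (Symbol L)) (lhs rhs : L.Term V) : Prop where
  lhs_mem : lhs ∈ termsOver V F
  rhs_mem : rhs ∈ termsOver V F
  lhs_ne_var : ∀ x : V, lhs ≠ .var x
  vars_subset : vars rhs ⊆ vars lhs

/-- A term rewrite system (TRS): a signature and a (possibly infinite) set of rewrite rules
over it. -/
structure TRS (L : FirstOrder.Language.{u, v}) (V : Type w) where
  sig : Set (Symbol L)
  rules : Set (L.Term V × L.Term V)
  isRule : ∀ ρ ∈ rules, IsRule sig ρ.1 ρ.2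

theorem IsRule.mono {F G : Set (Symbol L)} (h : F ⊆ G) {l r : L.Term V} (hr : IsRule F l r) :
    IsRule G l r :=
  ⟨fun _ hx => h (hr.lhs_mem hx), fun _ hx => h (hr.rhs_mem hx), hr.lhs_ne_var, hr.vars_subset⟩

/-- The union of two TRSs: the union of the rules, over the union of the signatures. -/
instance : Union (TRS L V) where
  union R S :=
    { sig := R.sig ∪ S.sig
      rules := R.rules ∪ S.rules
      isRule := by
        rintro ρ (h | h)
        · exact (R.isRule ρ h).mono Set.subset_union_left
        · exact (S.isRule ρ h).mono Set.subset_union_right }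

/-- The rewrite relation of a set of rules: the closure of the rules under substitutions and
contexts. -/
inductive Step (rules : Set (L.Term V × L.Term V)) : L.Term V → L.Term V → Prop
  | root {l r : L.Term V} (h : (l, r) ∈ rules) (σ : V → L.Term V) :
      Step rules (l.subst σ) (r.subst σ)
  | arg {n : ℕ} (f : L.Functions n) (ts : Fin n → L.Term V) (i : Fin n) {t : L.Term V}
      (h : Step rules (ts i) t) :
      Step rules (.func f ts) (.func f (Function.update ts i t))

theorem funs_subst (t : L.Term V) (σ : V → L.Term V) :
    funs (t.subst σ) = funs t ∪ ⋃ x ∈ vars t, funs (σ x) := by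
  induction t with
  | var x => simp [Term.subst, funs, vars]
  | func f ts ih =>
    ext y
    simp only [Term.subst, funs, vars, ih, Set.mem_insert_iff, Set.mem_iUnion, Set.mem_union]
    grind

/-- The terms over the signature of a TRS are closed under its rewrite relation. -/
theorem Step.mem_termsOver (R : TRS L V) {s t : L.Term V} (h : Step R.rules s t)
    (hs : s ∈ termsOver V R.sig) : t ∈ termsOver V R.sig := by
  induction h with
  | root h σ =>
    have hr := R.isRule _ h
    simp only [termsOver, Set.mem_ofPred_eq, funs_subst, Set.union_subset_iff] at hs ⊢
    exact ⟨hr.rhs_mem, (Set.biUnion_subset_biUnion_left hr.vars_subset).trans hs.2⟩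
  | arg f ts i h ih =>
    simp only [termsOver, Set.mem_ofPred_eq, funs, Set.insert_subset_iff,
      Set.iUnion_subset_iff] at hs ih ⊢
    refine ⟨hs.1, fun j => ?_⟩
    by_cases hj : j = i
    · subst hj
      simpa using ih (hs.2 j)
    · simpa [hj] using hs.2 j

/-- A TRS is confluent if its rewrite relation on the terms over its own signature is confluent.
These terms are closed under rewriting, so only the start of a peak has to be restricted. -/
def TRS.Confluent (R : TRS L V) : Prop :=
  ∀ s ∈ termsOver V R.sig, ∀ t u : L.Term V,
    Relation.ReflTransGen (Step R.rules) s t → Relation.ReflTransGen (Step R.rules) s u →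
      ∃ w : L.Term V,
        Relation.ReflTransGen (Step R.rules) t w ∧ Relation.ReflTransGen (Step R.rules) u w

/-- A term is quasi-ground (with respect to two signatures `F₁` and `F₂`) if all its subterms
that are rooted in a shared function symbol are ground terms over `F₁ ∪ F₂`. -/
def QuasiGround (F₁ F₂ : Set (Symbol L)) (t : L.Term V) : Prop :=
  ∀ s : L.Term V, Subterm s t → RootIn (F₁ ∩ F₂) s → s ∈ groundTerms V (F₁ ∪ F₂)

end Rewriting

/-!
Every term splits uniquely into a top `F`-layer and the maximal aliens below it. Since the rules are
quasi-ground with unshared left-hand roots, a step of `R ∪ S` either applies a rule of `R` to the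
top layer or rewrites one of the aliens. If the aliens lie in a set of confluent terms that is
closed under rewriting and contains only aliens, replace each of them by a variable for its
joinability class: steps in aliens become invisible, so confluence of `R` on the top layer closes
every peak, and representatives of the classes pull the result back.

In general an alien may collapse, that is, lose its foreign root, and merge with the layer above.
But every term has a reduct none of whose aliens can collapse, and rewriting the aliens of a term
to such reducts before joining reduces the general case to the previous one. Induction on the number
of layers then yields confluence everywhere; a term with a shared root is rewritten only in its
arguments.
-/

namespace Rewriting

open FirstOrder FirstOrder.Language Relation Function

universe u v

section AbstractRewriting

variable {α : Type*} {r : α → α → Prop} {a b c : α}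

theorem mem_of_reflTransGen {T : Set α} (hT : ∀ a ∈ T, ∀ b, r a b → b ∈ T) (ha : a ∈ T)
    (hab : ReflTransGen r a b) : b ∈ T := by
  induction hab with
  | refl => exact ha
  | tail _ hbc hb => exact hT _ hb _ hbc

/-- Confluence of the relation `r` at a single element: any two reducts of `a` have a common
reduct. -/
def ConfluentAt (r : α → α → Prop) (a : α) : Prop :=
  ∀ ⦃b c⦄, ReflTransGen r a b → ReflTransGen r a c → Join (ReflTransGen r) b c

theorem ConfluentAt.join_trans (hb : ConfluentAt r b) (hab : Join (ReflTransGen r) a b)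
    (hbc : Join (ReflTransGen r) b c) : Join (ReflTransGen r) a c :=
  let ⟨_, had, hbd⟩ := hab
  let ⟨_, hbe, hce⟩ := hbc
  let ⟨w, hdw, hew⟩ := hb hbd hbe
  ⟨w, had.trans hdw, hce.trans hew⟩

theorem ConfluentAt.exists_common_reduct (ha : ConfluentAt r a) {S : Set α} (hS : S.Finite)
    (hjoin : ∀ b ∈ S, Join (ReflTransGen r) a b) :
    ∃ c, ReflTransGen r a c ∧ ∀ b ∈ S, ReflTransGen r b c := by
  induction S, hS using Set.Finite.induction_on with
  | empty => exact ⟨a, .refl, by simp⟩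
  | insert _ _ ih =>
    obtain ⟨c, hac, hSc⟩ := ih fun b hb => hjoin b (.inr hb)
    obtain ⟨d, had, hbd⟩ := hjoin _ (.inl rfl)
    obtain ⟨e, hce, hde⟩ := ha hac had
    refine ⟨e, hac.trans hce, ?_⟩
    rintro b (rfl | hb)
    exacts [hbd.trans hde, (hSc b hb).trans hce]

/-- The elements joinable with `a`. On confluent elements joinability is an equivalence relation,
and this is the equivalence class of `a`. -/
def joinClass (r : α → α → Prop) (a : α) : Set α :=
  {b | Join (ReflTransGen r) a b}

theorem ConfluentAt.joinClass_eq (ha : ConfluentAt r a) (hab : r a b) :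
    joinClass r a = joinClass r b := by
  ext c
  constructor
  · rintro ⟨d, had, hcd⟩
    obtain ⟨e, hde, hbe⟩ := ha had (.single hab)
    exact ⟨e, hbe, hcd.trans hde⟩
  · rintro ⟨d, hbd, hcd⟩
    exact ⟨d, hbd.head hab, hcd⟩

theorem join_of_joinClass_eq (h : joinClass r a = joinClass r b) :
    Join (ReflTransGen r) a b :=
  (h.symm ▸ ⟨b, .refl, .refl⟩ : b ∈ joinClass r a)

theorem exists_common_reduct_of_joinClass [Nonempty α] {S : Set α} (hS : S.Finite)
    (hconf : ∀ a ∈ S, ConfluentAt r a) :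
    ∃ g : Set α → α, ∀ a ∈ S, ReflTransGen r a (g (joinClass r a)) := by
  have h : ∀ p : Set α, ∃ w, ∀ a ∈ S, joinClass r a = p → ReflTransGen r a w := by
    intro p
    by_cases hp : ∃ a ∈ S, joinClass r a = p
    · obtain ⟨a, ha, rfl⟩ := hp
      obtain ⟨w, -, hw⟩ := (hconf a ha).exists_common_reduct
        (hS.subset (Set.sep_subset S (joinClass r · = joinClass r a)))
        fun b hb => join_of_joinClass_eq hb.2.symm
      exact ⟨w, fun b hb hba => hw b ⟨hb, hba⟩⟩
    · exact ⟨Classical.arbitrary α, fun a ha hap => absurd ⟨a, ha, hap⟩ hp⟩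
  choose g hg using h
  exact ⟨g, fun a ha => hg _ a ha rfl⟩

theorem confluentAt_of_reduct_map {T : Set α} {φ : α → α} (hT : ∀ a ∈ T, ∀ b, r a b → b ∈ T)
    (hred : ∀ a ∈ T, ReflTransGen r a (φ a)) (hconf : ∀ a ∈ T, ConfluentAt r (φ a))
    (hjoin : ∀ a ∈ T, ∀ b, r a b → Join (ReflTransGen r) (φ a) (φ b)) (ha : a ∈ T) :
    ConfluentAt r a := by
  have hjoin_of_red : ∀ {b}, ReflTransGen r a b → Join (ReflTransGen r) (φ a) (φ b) := by
    intro b hab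
    induction hab with
    | refl => exact ⟨φ a, .refl, .refl⟩
    | tail hab hbc ih =>
      have hb := mem_of_reflTransGen hT ha hab
      exact (hconf _ hb).join_trans ih (hjoin _ hb _ hbc)
  intro b c hab hac
  obtain ⟨d, had, hbd⟩ := hjoin_of_red hab
  obtain ⟨e, hae, hce⟩ := hjoin_of_red hac
  obtain ⟨w, hdw, hew⟩ := hconf a ha had hae
  exact ⟨w, (hred b (mem_of_reflTransGen hT ha hab)).trans (hbd.trans hdw),
    (hred c (mem_of_reflTransGen hT ha hac)).trans (hce.trans hew)⟩

end AbstractRewriting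

variable {L : FirstOrder.Language.{u, v}} {V X Y Z : Type*}

section Substitution

theorem subst_subst (t : L.Term X) (σ : X → L.Term Y) (τ : Y → L.Term Z) :
    (t.subst σ).subst τ = t.subst fun x => (σ x).subst τ := by
  induction t with
  | var x => rfl
  | func f ts ih => simp only [Term.subst, ih]

theorem subst_var (t : L.Term X) : t.subst .var = t := by
  induction t with
  | var x => rfl
  | func f ts ih => simp only [Term.subst, ih]

theorem subst_congr {t : L.Term X} {σ τ : X → L.Term Y} (h : ∀ x ∈ vars t, σ x = τ x) :
    t.subst σ = t.subst τ := by
  induction t with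
  | var x => exact h x rfl
  | func f ts ih =>
    exact congrArg (Term.func f) <| funext fun i =>
      ih i fun x hx => h x (Set.mem_iUnion_of_mem i hx)

theorem subst_func_update {n : ℕ} (f : L.Functions n) (ts : Fin n → L.Term X) (i : Fin n)
    (t : L.Term X) (σ : X → L.Term Y) :
    (Term.func f (update ts i t)).subst σ =
      .func f (update (fun j => (ts j).subst σ) i (t.subst σ)) :=
  congrArg (Term.func f) (comp_update (fun s : L.Term X => s.subst σ) ts i t)

theorem vars_subst (t : L.Term X) (σ : X → L.Term Y) :
    vars (t.subst σ) = ⋃ x ∈ vars t, vars (σ x) := by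
  induction t with
  | var x => simp [Term.subst, vars]
  | func f ts ih => simp only [Term.subst, vars, ih, Set.biUnion_iUnion]

theorem vars_finite (t : L.Term X) : (vars t).Finite := by
  induction t with
  | var x => exact Set.finite_singleton x
  | func _ _ ih => exact Set.finite_iUnion ih

theorem vars_func_eq_empty_iff {n : ℕ} {f : L.Functions n} {ts : Fin n → L.Term X} :
    vars (.func f ts) = ∅ ↔ ∀ i, vars (ts i) = ∅ :=
  Set.iUnion_eq_empty

theorem func_mem_termsOver_iff {F : Set (Symbol L)} {n : ℕ} {f : L.Functions n}
    {ts : Fin n → L.Term X} :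
    .func f ts ∈ termsOver X F ↔ ⟨n, f⟩ ∈ F ∧ ∀ i, ts i ∈ termsOver X F :=
  Set.insert_subset_iff.trans (and_congr_right' Set.iUnion_subset_iff)

theorem subst_mem_termsOver {F : Set (Symbol L)} {t : L.Term X} {σ : X → L.Term Y}
    (ht : t ∈ termsOver X F) (hσ : ∀ x ∈ vars t, σ x ∈ termsOver Y F) :
    t.subst σ ∈ termsOver Y F := by
  induction t with
  | var x => exact hσ x rfl
  | func _ ts ih =>
    obtain ⟨hf, hts⟩ := func_mem_termsOver_iff.1 ht
    exact func_mem_termsOver_iff.2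
      ⟨hf, fun i => ih i (hts i) fun x hx => hσ x (Set.mem_iUnion_of_mem i hx)⟩

theorem func_mem_groundTerms_iff {F : Set (Symbol L)} {n : ℕ} {f : L.Functions n}
    {ts : Fin n → L.Term X} :
    .func f ts ∈ groundTerms X F ↔ ⟨n, f⟩ ∈ F ∧ ∀ i, ts i ∈ groundTerms X F := by
  simp only [groundTerms, Set.mem_ofPred_eq, func_mem_termsOver_iff, vars_func_eq_empty_iff,
    forall_and, and_assoc]

theorem subst_mem_groundTerms_iff {F : Set (Symbol L)} {t : L.Term X} {σ : X → L.Term Y} :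
    t.subst σ ∈ groundTerms Y F ↔ t ∈ termsOver X F ∧ ∀ x ∈ vars t, σ x ∈ groundTerms Y F := by
  induction t with
  | var x => simp [Term.subst, vars, termsOver, funs]
  | func f ts ih =>
    simp only [Term.subst, func_mem_groundTerms_iff, ih, func_mem_termsOver_iff, vars,
      Set.mem_iUnion]
    grind

theorem rootIn_inter {F G : Set (Symbol L)} {t : L.Term X} :
    RootIn (F ∩ G) t ↔ RootIn F t ∧ RootIn G t := by
  cases t with
  | var x => exact (and_self_iff (a := False)).symm
  | func f ts => rfl

theorem rootIn_subst {F : Set (Symbol L)} {t : L.Term X} (ht : ∀ x, t ≠ .var x)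
    (σ : X → L.Term Y) : RootIn F (t.subst σ) ↔ RootIn F t := by
  cases t with
  | var x => exact absurd rfl (ht x)
  | func f ts => rfl

theorem rootIn_of_mem_termsOver {F : Set (Symbol L)} {t : L.Term X} (ht : t ∈ termsOver X F)
    (hvar : ∀ x, t ≠ .var x) : RootIn F t := by
  cases t with
  | var x => exact absurd rfl (hvar x)
  | func f ts => exact (func_mem_termsOver_iff.1 ht).1

end Substitution

section Rewrite

/-- The rewrite relation of a set of rules on terms over an arbitrary set `X` of variables, which
need not be the set `V` of variables of the rules: below, the variables of a term stand for the
subterms under its top layer. -/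
inductive Rewrite (P : Set (L.Term V × L.Term V)) : L.Term X → L.Term X → Prop
  | root {l r : L.Term V} (h : (l, r) ∈ P) (σ : V → L.Term X) :
      Rewrite P (l.subst σ) (r.subst σ)
  | arg {n : ℕ} (f : L.Functions n) (ts : Fin n → L.Term X) (i : Fin n) {t : L.Term X}
      (h : Rewrite P (ts i) t) : Rewrite P (.func f ts) (.func f (update ts i t))

/-- Rewriting in any finite number of steps. -/
abbrev Reduces (P : Set (L.Term V × L.Term V)) : L.Term X → L.Term X → Prop :=
  ReflTransGen (Rewrite P)

variable {P Q : Set (L.Term V × L.Term V)} {s t : L.Term X}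

theorem step_eq_rewrite : Step P = Rewrite P := by
  ext s t
  constructor <;> intro h
  · induction h with
    | root h σ => exact .root h σ
    | arg f ts i _ ih => exact .arg f ts i ih
  · induction h with
    | root h σ => exact .root h σ
    | arg f ts i _ ih => exact .arg f ts i ih

theorem Rewrite.mono (hPQ : P ⊆ Q) (h : Rewrite P s t) : Rewrite Q s t := by
  induction h with
  | root h σ => exact .root (hPQ h) σ
  | arg f ts i _ ih => exact .arg f ts i ih

theorem Rewrite.subst (h : Rewrite P s t) (σ : X → L.Term Y) :
    Rewrite P (s.subst σ) (t.subst σ) := by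
  induction h with
  | root h τ => simpa only [subst_subst] using Rewrite.root h _
  | arg f ts i _ ih =>
    rw [subst_func_update]
    exact .arg f (fun j => (ts j).subst σ) i ih

theorem Reduces.subst (h : Reduces P s t) (σ : X → L.Term Y) :
    Reduces P (s.subst σ) (t.subst σ) :=
  h.lift (fun q => q.subst σ) fun _ _ h => h.subst σ

theorem Reduces.mono (hPQ : P ⊆ Q) (h : Reduces P s t) : Reduces Q s t :=
  h.lift id fun _ _ h => h.mono hPQ

theorem Rewrite.vars_subset (hP : ∀ ρ ∈ P, vars ρ.2 ⊆ vars ρ.1) (h : Rewrite P s t) :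
    vars t ⊆ vars s := by
  induction h with
  | root h σ =>
    rw [vars_subst, vars_subst]
    exact Set.biUnion_subset_biUnion_left (hP _ h)
  | arg f ts i _ ih =>
    refine Set.iUnion_subset fun j => ?_
    refine subset_trans ?_ (Set.subset_iUnion (fun j => vars (ts j)) j)
    obtain rfl | hj := eq_or_ne j i
    · simpa only [update_self] using ih
    · rw [update_of_ne hj]

theorem Reduces.vars_subset (hP : ∀ ρ ∈ P, vars ρ.2 ⊆ vars ρ.1) (h : Reduces P s t) :
    vars t ⊆ vars s :=
  mem_of_reflTransGen (T := {q | vars q ⊆ vars s}) (fun _ hq _ h => (h.vars_subset hP).trans hq)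
    (Set.Subset.refl (vars s)) h

theorem reduces_func_update {n : ℕ} (f : L.Functions n) (ts : Fin n → L.Term X) (i : Fin n)
    (h : Reduces P (ts i) t) : Reduces P (.func f ts) (.func f (update ts i t)) := by
  have hlift : Reduces P (.func f (update ts i (ts i))) (.func f (update ts i t)) :=
    h.lift (fun q => Term.func f (update ts i q)) fun p q hpq => by
      simpa only [update_idem] using
        Rewrite.arg f (update ts i p) i (by simpa only [update_self] using hpq)
  rwa [update_eq_self] at hlift

theorem reduces_func {n : ℕ} (f : L.Functions n) {ts us : Fin n → L.Term X}
    (h : ∀ i, Reduces P (ts i) (us i)) : Reduces P (.func f ts) (.func f us) := by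
  have hpiecewise (A : Finset (Fin n)) :
      Reduces P (.func f ts) (.func f (A.piecewise us ts)) := by
    induction A using Finset.induction_on with
    | empty => simpa only [Finset.piecewise_empty] using ReflTransGen.refl
    | insert i A hi ih =>
      rw [Finset.piecewise_insert]
      refine ih.trans (reduces_func_update f _ i ?_)
      rw [Finset.piecewise_eq_of_notMem _ _ _ hi]
      exact h i
  simpa only [Finset.piecewise_univ] using hpiecewise Finset.univ

theorem reduces_subst (t : L.Term X) {σ τ : X → L.Term Y}
    (h : ∀ x ∈ vars t, Reduces P (σ x) (τ x)) : Reduces P (t.subst σ) (t.subst τ) := by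
  induction t with
  | var x => exact h x rfl
  | func f ts ih => exact reduces_func f fun i => ih i fun x hx => h x (Set.mem_iUnion_of_mem i hx)

theorem join_subst (t : L.Term X) {σ τ : X → L.Term Y}
    (h : ∀ x ∈ vars t, Join (Reduces P) (σ x) (τ x)) :
    Join (Reduces P) (t.subst σ) (t.subst τ) := by
  have hex : ∀ x, ∃ w, x ∈ vars t → Reduces P (σ x) w ∧ Reduces P (τ x) w := fun x => by
    by_cases hx : x ∈ vars t
    · exact (h x hx).imp fun _ hw _ => hw
    · exact ⟨σ x, fun hx' => absurd hx' hx⟩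
  choose w hw using hex
  exact ⟨t.subst w, reduces_subst t fun x hx => (hw x hx).1,
    reduces_subst t fun x hx => (hw x hx).2⟩

theorem not_rewrite_var (hP : ∀ ρ ∈ P, ∀ x, ρ.1 ≠ .var x) {x : X} : ¬Rewrite P (.var x) t := by
  generalize hs : Term.var x = s
  intro h
  cases h with
  | @root l _ h σ =>
    cases l with
    | var y => exact hP _ h y rfl
    | func f ts => cases hs
  | arg f ts i h => cases hs

theorem reduces_var_iff (hP : ∀ ρ ∈ P, ∀ x, ρ.1 ≠ .var x) {x : X} :
    Reduces P (.var x) t ↔ t = .var x :=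
  reflTransGen_iff_eq fun _ => not_rewrite_var hP

section ConstructorRoot

variable {C : Set (Symbol L)} {n : ℕ} {f : L.Functions n} {ts : Fin n → L.Term X}

theorem Rewrite.exists_arg (hP : ∀ ρ ∈ P, ∀ x, ρ.1 ≠ .var x) (hC : ∀ ρ ∈ P, ¬RootIn C ρ.1)
    (hf : ⟨n, f⟩ ∈ C) (h : Rewrite P (.func f ts) t) :
    ∃ i u, Rewrite P (ts i) u ∧ t = .func f (update ts i u) := by
  generalize hs : Term.func f ts = s at h
  cases h with
  | root h σ => exact absurd ((rootIn_subst (hP _ h) σ).1 (hs ▸ hf)) (hC _ h)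
  | @arg _ _ _ i u h =>
    cases hs
    exact ⟨i, u, h, rfl⟩

theorem Reduces.exists_args (hP : ∀ ρ ∈ P, ∀ x, ρ.1 ≠ .var x) (hC : ∀ ρ ∈ P, ¬RootIn C ρ.1)
    (hf : ⟨n, f⟩ ∈ C) (h : Reduces P (.func f ts) t) :
    ∃ us : Fin n → L.Term X, t = .func f us ∧ ∀ i, Reduces P (ts i) (us i) := by
  induction h with
  | refl => exact ⟨ts, rfl, fun _ => .refl⟩
  | tail _ hstep ih =>
    obtain ⟨us, rfl, hus⟩ := ih
    obtain ⟨i, u, hu, rfl⟩ := hstep.exists_arg hP hC hf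
    exact ⟨_, rfl, (forall_update_iff us fun j q => Reduces P (ts j) q).2
      ⟨(hus i).tail hu, fun j _ => hus j⟩⟩

theorem confluentAt_func (hP : ∀ ρ ∈ P, ∀ x, ρ.1 ≠ .var x) (hC : ∀ ρ ∈ P, ¬RootIn C ρ.1)
    (hf : ⟨n, f⟩ ∈ C) (hts : ∀ i, ConfluentAt (Rewrite P) (ts i)) :
    ConfluentAt (Rewrite P) (.func f ts) := by
  intro t u ht hu
  obtain ⟨ts', rfl, hts'⟩ := Reduces.exists_args hP hC hf ht
  obtain ⟨us', rfl, hus'⟩ := Reduces.exists_args hP hC hf hu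
  choose ws htw huw using fun i => hts i (hts' i) (hus' i)
  exact ⟨.func f ws, reduces_func f htw, reduces_func f huw⟩

end ConstructorRoot

end Rewrite

namespace TRS

theorem union_comm (R S : TRS L V) : R ∪ S = S ∪ R := by
  cases R
  cases S
  simp only [Union.union, mk.injEq]
  exact ⟨Set.union_comm _ _, Set.union_comm _ _⟩

variable {R : TRS L V}

theorem vars_rhs_subset {ρ : L.Term V × L.Term V} (hρ : ρ ∈ R.rules) : vars ρ.2 ⊆ vars ρ.1 :=
  (R.isRule ρ hρ).vars_subset

theorem lhs_ne_var {ρ : L.Term V × L.Term V} (hρ : ρ ∈ R.rules) (x : V) : ρ.1 ≠ .var x :=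
  (R.isRule ρ hρ).lhs_ne_var x

theorem confluent_iff :
    R.Confluent ↔ ∀ s ∈ termsOver V R.sig, ConfluentAt (Rewrite R.rules) s := by
  rw [← step_eq_rewrite]
  rfl

/-- The finitely many variables of a term can be renamed into the infinite set `V`, and the
renaming can be undone after rewriting because rewriting introduces no variables. -/
theorem Confluent.confluentAt [Infinite V] (hR : R.Confluent) {s : L.Term X}
    (hs : s ∈ termsOver X R.sig) : ConfluentAt (Rewrite R.rules) s := by
  obtain ⟨ρ, -, hρ⟩ := (vars_finite s).exists_injOn_of_encard_le
    (t := (Set.univ : Set V)) (by simp [Set.encard_eq_top Set.infinite_univ])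
  let back : V → L.Term X := extend ((vars s).domRestrict ρ) (fun x => .var x) fun _ => s
  have hback_var : ∀ x ∈ vars s, back (ρ x) = .var x := fun x hx =>
    hρ.injective.extend_apply _ _ ⟨x, hx⟩
  have hback {q : L.Term X} (hq : Reduces R.rules s q) : (q.subst (.var ∘ ρ)).subst back = q := by
    rw [subst_subst]
    conv_rhs => rw [← subst_var q]
    exact subst_congr fun x hx =>
      hback_var x (Reduces.vars_subset (fun _ => vars_rhs_subset) hq hx)
  intro t u ht hu
  obtain ⟨w, htw, huw⟩ := confluent_iff.1 hR (s.subst (.var ∘ ρ))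
    (subst_mem_termsOver hs fun _ _ => Set.empty_subset _)
    (Reduces.subst ht _) (Reduces.subst hu _)
  exact ⟨w.subst back, hback ht ▸ Reduces.subst htw back, hback hu ▸ Reduces.subst huw back⟩

end TRS

section Layer

variable {F G : Set (Symbol L)}

theorem quasiGround_comm {t : L.Term X} : QuasiGround F G t ↔ QuasiGround G F t := by
  simp only [QuasiGround, Set.inter_comm F G, Set.union_comm F G]

/-- The terms that can serve as the `F`-layer of a term over `F ∪ G`: the quasi-ground terms over
`F`, with variables in the places of the subterms below the layer. -/
def IsLayer (F G : Set (Symbol L)) (C : L.Term X) : Prop :=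
  C ∈ termsOver X F ∧ QuasiGround F G C

theorem isLayer_var (x : X) : IsLayer F G (.var x : L.Term X) := by
  refine ⟨Set.empty_subset _, fun s hs hroot => ?_⟩
  cases hs
  exact hroot.elim

theorem isLayer_func_iff {n : ℕ} {f : L.Functions n} {ts : Fin n → L.Term X} :
    IsLayer F G (.func f ts) ↔ ⟨n, f⟩ ∈ F ∧ (∀ i, IsLayer F G (ts i)) ∧
      (⟨n, f⟩ ∈ G → ∀ i, vars (ts i) = ∅) := by
  constructor
  · rintro ⟨hover, hqg⟩
    obtain ⟨hf, hts⟩ := func_mem_termsOver_iff.1 hover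
    exact ⟨hf, fun i => ⟨hts i, fun s hs => hqg s (.arg f ts i hs)⟩,
      fun hfG => vars_func_eq_empty_iff.1 (hqg _ (.refl _) ⟨hf, hfG⟩).2⟩
  · rintro ⟨hf, hts, hground⟩
    have hover := func_mem_termsOver_iff.2 ⟨hf, fun i => (hts i).1⟩
    refine ⟨hover, fun s hs hroot => ?_⟩
    cases hs with
    | refl => exact ⟨hover.trans Set.subset_union_left, vars_func_eq_empty_iff.2 (hground hroot.2)⟩
    | arg _ _ i hs => exact (hts i).2 s hs hroot

/-- A term that is cut off below an `F`-layer: a variable, a term whose root is outside `F`, or a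
term with a shared root that is not ground over `F` (layers are quasi-ground, so no variable, and
hence no alien, may occur below a shared symbol of a layer). -/
def Alien (F G : Set (Symbol L)) (t : L.Term V) : Prop :=
  RootIn F t → RootIn G t ∧ t ∉ groundTerms V F

theorem not_alien_func_iff {n : ℕ} {f : L.Functions n} {ts : Fin n → L.Term V} :
    ¬Alien F G (.func f ts) ↔ ⟨n, f⟩ ∈ F ∧ (⟨n, f⟩ ∈ G → .func f ts ∈ groundTerms V F) := by
  simp only [Alien, RootIn, Classical.not_imp, not_and, not_not]

theorem mem_groundTerms_of_not_alien {t : L.Term V} (hF : ¬Alien F G t) (hG : ¬Alien G F t) :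
    t ∈ groundTerms V F := by
  by_contra ht
  exact hF fun _ => ⟨(Classical.not_imp.1 hG).1, ht⟩

open Classical in
/-- The top `F`-layer of a term, in which the maximal aliens are the variables. -/
noncomputable def top (F G : Set (Symbol L)) : L.Term V → L.Term (L.Term V)
  | .var x => .var (.var x)
  | .func f ts =>
    if Alien F G (.func f ts) then .var (.func f ts) else .func f fun i => top F G (ts i)

/-- The maximal aliens of a term: the subterms directly below its top `F`-layer. -/
def aliens (F G : Set (Symbol L)) (t : L.Term V) : Set (L.Term V) :=
  vars (top F G t)

theorem top_of_alien {t : L.Term V} (h : Alien F G t) : top F G t = .var t := by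
  cases t with
  | var x => rfl
  | func f ts => exact if_pos h

theorem top_func {n : ℕ} {f : L.Functions n} {ts : Fin n → L.Term V}
    (h : ¬Alien F G (.func f ts)) : top F G (.func f ts) = .func f fun i => top F G (ts i) :=
  if_neg h

theorem top_func_update {n : ℕ} {f : L.Functions n} {ts : Fin n → L.Term V} {i : Fin n}
    {t : L.Term V} (h : ¬Alien F G (.func f (update ts i t))) :
    top F G (.func f (update ts i t)) =
      .func f (update (fun j => top F G (ts j)) i (top F G t)) :=
  (top_func h).trans (congrArg (Term.func f) (comp_update (top F G) ts i t))

theorem aliens_of_alien {t : L.Term V} (h : Alien F G t) : aliens F G t = {t} := by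
  rw [aliens, top_of_alien h, vars]

theorem aliens_func {n : ℕ} {f : L.Functions n} {ts : Fin n → L.Term V}
    (h : ¬Alien F G (.func f ts)) : aliens F G (.func f ts) = ⋃ i, aliens F G (ts i) := by
  rw [aliens, top_func h, vars]
  rfl

theorem top_subst_id (t : L.Term V) : (top F G t).subst id = t := by
  induction t with
  | var x => rfl
  | func f ts ih =>
    by_cases h : Alien F G (.func f ts)
    · rw [top_of_alien h, Term.subst, id]
    · simp only [top_func h, Term.subst, ih]

theorem aliens_eq_empty {t : L.Term V} (ht : t ∈ groundTerms V F) : aliens F G t = ∅ := by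
  induction t with
  | var x => exact absurd ht.2 (Set.singleton_ne_empty x)
  | func f ts ih =>
    obtain ⟨hf, hts⟩ := func_mem_groundTerms_iff.1 ht
    rw [aliens_func (not_alien_func_iff.2 ⟨hf, fun _ => ht⟩)]
    exact Set.iUnion_eq_empty.2 fun i => ih i (hts i)

theorem isLayer_top (t : L.Term V) : IsLayer F G (top F G t) := by
  induction t with
  | var x => exact isLayer_var _
  | func f ts ih =>
    by_cases h : Alien F G (.func f ts)
    · rw [top_of_alien h]
      exact isLayer_var _
    · obtain ⟨hf, hground⟩ := not_alien_func_iff.1 h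
      rw [top_func h]
      exact isLayer_func_iff.2 ⟨hf, ih, fun hfG i =>
        aliens_eq_empty ((func_mem_groundTerms_iff.1 (hground hfG)).2 i)⟩

theorem top_subst {C : L.Term X} (hC : IsLayer F G C) (σ : X → L.Term V) :
    top F G (C.subst σ) = C.subst fun x => top F G (σ x) := by
  induction C with
  | var x => rfl
  | func f ts ih =>
    obtain ⟨hf, hts, hground⟩ := isLayer_func_iff.1 hC
    have hnot : ¬Alien F G ((Term.func f ts).subst σ) := by
      refine not_alien_func_iff.2 ⟨hf, fun hfG => subst_mem_groundTerms_iff.2 ⟨hC.1, ?_⟩⟩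
      simp [vars_func_eq_empty_iff.2 (hground hfG)]
    exact (top_func hnot).trans (congrArg (Term.func f) (funext fun i => ih i (hts i)))

theorem aliens_subst {C : L.Term X} (hC : IsLayer F G C) (σ : X → L.Term V) :
    aliens F G (C.subst σ) = ⋃ x ∈ vars C, aliens F G (σ x) := by
  rw [aliens, top_subst hC, vars_subst]
  rfl

end Layer

section AlienRewrite

/-- The step from `s` to `t` takes place below the top `F`-layer: it rewrites an alien `a` of `s`
to `b`. The variable `none` of `E` marks the occurrence of `a` that is rewritten. -/
def AlienRewrite (F G : Set (Symbol L)) (P : Set (L.Term V × L.Term V)) (s t : L.Term V) : Prop :=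
  ∃ (E : L.Term (Option (L.Term V))) (a b : L.Term V), a ∈ aliens F G s ∧ Rewrite P a b ∧
    top F G s = E.subst (fun o => .var (o.getD a)) ∧
    top F G t = E.subst fun o => o.elim (top F G b) .var

variable {F G : Set (Symbol L)} {P : Set (L.Term V × L.Term V)} {s t : L.Term V}

theorem reduces_top_subst {σ : L.Term V → L.Term V} (hσ : ∀ a ∈ aliens F G s, Reduces P a (σ a)) :
    Reduces P s ((top F G s).subst σ) := by
  simpa only [top_subst_id] using reduces_subst (top F G s) (σ := id) hσ

theorem AlienRewrite.of_alien (hs : Alien F G s) (h : Rewrite P s t) : AlienRewrite F G P s t :=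
  ⟨.var none, s, t, aliens_of_alien hs ▸ rfl, h, top_of_alien hs, rfl⟩

theorem AlienRewrite.arg {n : ℕ} {f : L.Functions n} {ts : Fin n → L.Term V} {i : Fin n}
    (hs : ¬Alien F G (.func f ts)) (ht : ¬Alien F G (.func f (update ts i t)))
    (h : AlienRewrite F G P (ts i) t) :
    AlienRewrite F G P (.func f ts) (.func f (update ts i t)) := by
  obtain ⟨E, a, b, ha, hab, hsE, htE⟩ := h
  refine ⟨.func f (update (fun j => (top F G (ts j)).subst fun c => .var (some c)) i E), a, b,
    aliens_func hs ▸ Set.mem_iUnion_of_mem i ha, hab, ?_, ?_⟩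
  · rw [top_func hs, subst_func_update]
    simp only [subst_subst, Term.subst, Option.getD_some, subst_var, ← hsE, update_eq_self]
  · rw [top_func_update ht, subst_func_update]
    simp only [subst_subst, Term.subst, Option.elim_some, subst_var, ← htE]

theorem AlienRewrite.aliens_subset {K : Set (L.Term V)}
    (hK : ∀ a ∈ K, ∀ b, Rewrite P a b → aliens F G b ⊆ K) (hs : aliens F G s ⊆ K)
    (h : AlienRewrite F G P s t) : aliens F G t ⊆ K := by
  obtain ⟨E, a, b, ha, hab, hsE, htE⟩ := h
  have hb := hK a (hs ha) b hab
  rw [aliens, hsE, vars_subst, Set.iUnion₂_subset_iff] at hs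
  rw [aliens, htE, vars_subst, Set.iUnion₂_subset_iff]
  rintro (_ | c) hc
  · exact hb
  · exact hs (some c) hc

/-- The top `F`-layer of a term, in which every maximal alien is replaced by a variable that stands
for its joinability class. -/
noncomputable def classTerm (F G : Set (Symbol L)) (P : Set (L.Term V × L.Term V))
    (s : L.Term V) : L.Term (Set (L.Term V)) :=
  (top F G s).subst fun a => .var (joinClass (Rewrite P) a)

theorem AlienRewrite.classTerm_eq {N : Set (L.Term V)} (hconf : ∀ a ∈ N, ConfluentAt (Rewrite P) a)
    (hN : ∀ a ∈ N, ∀ b, Rewrite P a b → Alien F G b) (hs : aliens F G s ⊆ N)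
    (h : AlienRewrite F G P s t) : classTerm F G P s = classTerm F G P t := by
  obtain ⟨E, a, b, ha, hab, hsE, htE⟩ := h
  rw [classTerm, classTerm, hsE, htE, subst_subst, subst_subst, top_of_alien (hN a (hs ha) b hab)]
  refine subst_congr ?_
  rintro (_ | c) -
  · exact congrArg Term.var ((hconf a (hs ha)).joinClass_eq hab)
  · rfl

end AlienRewrite

section PreservedAliens

/-- The aliens that remain aliens under rewriting, so that their rewriting never changes the layer
above them. -/
def preservedAliens (F G : Set (Symbol L)) (P : Set (L.Term V × L.Term V)) : Set (L.Term V) :=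
  {a | ∀ b, Reduces P a b → Alien F G b}

/-- Every element of `K` has a reduct all of whose aliens are preserved. -/
def HasInnerPreservedReducts (F G : Set (Symbol L)) (P : Set (L.Term V × L.Term V))
    (K : Set (L.Term V)) : Prop :=
  ∀ a ∈ K, ∃ b, Reduces P a b ∧ aliens F G b ⊆ preservedAliens F G P

/-- A set of terms that is closed under arguments (hence under subterms) and under rewriting. -/
structure Hereditary (P : Set (L.Term V × L.Term V)) (K : Set (L.Term V)) : Prop where
  arg_mem : ∀ {n : ℕ} {f : L.Functions n} {ts : Fin n → L.Term V}, .func f ts ∈ K → ∀ i, ts i ∈ K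
  rewrite_mem : ∀ a ∈ K, ∀ b, Rewrite P a b → b ∈ K

variable {F G : Set (Symbol L)} {P : Set (L.Term V × L.Term V)} {K : Set (L.Term V)}

theorem mem_preservedAliens_of_rewrite {a b : L.Term V} (ha : a ∈ preservedAliens F G P)
    (hab : Rewrite P a b) : b ∈ preservedAliens F G P :=
  fun c hbc => ha c (hbc.head hab)

theorem Hereditary.aliens_subset (hK : Hereditary P K) {t : L.Term V} (ht : t ∈ K) :
    aliens F G t ⊆ K := by
  induction t with
  | var x => exact Set.singleton_subset_iff.2 ht
  | func f ts ih =>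
    by_cases h : Alien F G (.func f ts)
    · rw [aliens_of_alien h]
      exact Set.singleton_subset_iff.2 ht
    · rw [aliens_func h]
      exact Set.iUnion_subset fun i => ih i (hK.arg_mem ht i)

theorem Hereditary.aliens_arg_subset (hK : Hereditary P K) {n : ℕ} {f : L.Functions n}
    {ts : Fin n → L.Term V} (h : aliens F G (.func f ts) ⊆ K) (i : Fin n) :
    aliens F G (ts i) ⊆ K := by
  by_cases halien : Alien F G (.func f ts)
  · rw [aliens_of_alien halien] at h
    exact hK.aliens_subset (hK.arg_mem (h rfl) i)
  · rw [aliens_func halien] at h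
    exact (Set.subset_iUnion _ i).trans h

end PreservedAliens

section Rank

/-- The terms obtained by putting one more layer, an `F`-layer, a `G`-layer or a shared root, on
top of terms from `K`. -/
inductive AddLayer (F G : Set (Symbol L)) (K : Set (L.Term V)) : L.Term V → Prop
  | left {t : L.Term V} (h : aliens F G t ⊆ K) : AddLayer F G K t
  | right {t : L.Term V} (h : aliens G F t ⊆ K) : AddLayer F G K t
  | shared {n : ℕ} {f : L.Functions n} {ts : Fin n → L.Term V} (hf : ⟨n, f⟩ ∈ F ∩ G)
      (h : ∀ i, ts i ∈ K) : AddLayer F G K (.func f ts)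

/-- The terms of rank at most `k`, those with at most `k` layers above the variables. -/
def rankLE (V : Type*) (F G : Set (Symbol L)) : ℕ → Set (L.Term V)
  | 0 => Set.range .var
  | k + 1 => {t | AddLayer F G (rankLE V F G k) t}

variable {F G : Set (Symbol L)}

theorem AddLayer.symm {K : Set (L.Term V)} {t : L.Term V} (h : AddLayer F G K t) :
    AddLayer G F K t := by
  cases h with
  | left h => exact .right h
  | right h => exact .left h
  | shared hf h => exact .shared hf.symm h

theorem rankLE_comm (k : ℕ) : rankLE V F G k = rankLE V G F k := by
  induction k with
  | zero => rfl
  | succ k ih =>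
    rw [rankLE, rankLE, ih]
    exact Set.ext fun t => ⟨.symm, .symm⟩

end Rank

/-- The hypotheses of the modularity theorem on the rules of `R ∪ S`. -/
structure QuasiGroundUnion (R S : TRS L V) : Prop where
  not_rootIn_shared : ∀ ρ ∈ (R ∪ S).rules, ¬RootIn (R.sig ∩ S.sig) ρ.1
  quasiGround : ∀ ρ ∈ (R ∪ S).rules,
    QuasiGround R.sig S.sig ρ.1 ∧ QuasiGround R.sig S.sig ρ.2

namespace QuasiGroundUnion

variable {R S : TRS L V} {s t : L.Term V}

theorem symm (H : QuasiGroundUnion R S) : QuasiGroundUnion S R where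
  not_rootIn_shared := by
    simpa only [TRS.union_comm S R, Set.inter_comm S.sig] using H.not_rootIn_shared
  quasiGround := by
    simpa only [TRS.union_comm S R, quasiGround_comm (F := S.sig)] using H.quasiGround

theorem mem_rules_left (H : QuasiGroundUnion R S) {ρ : L.Term V × L.Term V}
    (hρ : ρ ∈ (R ∪ S).rules) (hroot : RootIn R.sig ρ.1) : ρ ∈ R.rules := by
  refine Or.resolve_right hρ fun hS => H.not_rootIn_shared ρ hρ (rootIn_inter.2 ⟨hroot, ?_⟩)
  exact rootIn_of_mem_termsOver (S.isRule ρ hS).lhs_mem (TRS.lhs_ne_var hS)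

theorem isLayer_lhs (H : QuasiGroundUnion R S) {ρ : L.Term V × L.Term V} (hρ : ρ ∈ R.rules) :
    IsLayer R.sig S.sig ρ.1 :=
  ⟨(R.isRule ρ hρ).lhs_mem, (H.quasiGround ρ (.inl hρ)).1⟩

theorem isLayer_rhs (H : QuasiGroundUnion R S) {ρ : L.Term V × L.Term V} (hρ : ρ ∈ R.rules) :
    IsLayer R.sig S.sig ρ.2 :=
  ⟨(R.isRule ρ hρ).rhs_mem, (H.quasiGround ρ (.inl hρ)).2⟩

theorem mem_groundTerms_of_rewrite (H : QuasiGroundUnion R S) (h : Rewrite (R ∪ S).rules s t)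
    (hs : s ∈ groundTerms V R.sig) : t ∈ groundTerms V R.sig := by
  induction h with
  | @root l r h σ =>
    obtain ⟨hl, hσ⟩ := subst_mem_groundTerms_iff.1 hs
    have hroot := rootIn_of_mem_termsOver hl (TRS.lhs_ne_var h)
    have hrule : IsRule R.sig l r := R.isRule _ (H.mem_rules_left h hroot)
    exact subst_mem_groundTerms_iff.2 ⟨hrule.rhs_mem, fun x hx => hσ x (hrule.vars_subset hx)⟩
  | arg f ts i _ ih =>
    obtain ⟨hf, hts⟩ := func_mem_groundTerms_iff.1 hs
    exact func_mem_groundTerms_iff.2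
      ⟨hf, (forall_update_iff ts fun _ q => q ∈ groundTerms V R.sig).2
        ⟨ih (hts i), fun j _ => hts j⟩⟩

theorem rewrite_top_or_alienRewrite (H : QuasiGroundUnion R S) (h : Rewrite (R ∪ S).rules s t) :
    Rewrite R.rules (top R.sig S.sig s) (top R.sig S.sig t) ∨
      AlienRewrite R.sig S.sig (R ∪ S).rules s t := by
  induction h with
  | @root l r h σ =>
    by_cases hs : Alien R.sig S.sig (l.subst σ)
    · exact .inr (.of_alien hs (.root h σ))
    have hroot : RootIn R.sig l :=
      (rootIn_subst (TRS.lhs_ne_var h) σ).1 (Classical.not_imp.1 hs).1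
    have hR := H.mem_rules_left h hroot
    rw [top_subst (H.isLayer_lhs hR), top_subst (H.isLayer_rhs hR)]
    exact .inl (.root hR _)
  | @arg n f ts i t h ih =>
    by_cases hs : Alien R.sig S.sig (.func f ts)
    · exact .inr (.of_alien hs (.arg f ts i h))
    have ht : ¬Alien R.sig S.sig (.func f (update ts i t)) := by
      obtain ⟨hf, hground⟩ := not_alien_func_iff.1 hs
      exact not_alien_func_iff.2
        ⟨hf, fun hfG => H.mem_groundTerms_of_rewrite (.arg f ts i h) (hground hfG)⟩
    obtain ih | ih := ih
    · rw [top_func hs, top_func_update ht]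
      exact .inl (.arg f (fun j => top R.sig S.sig (ts j)) i ih)
    · exact .inr (ih.arg hs ht)

theorem aliens_subset_of_rewrite (H : QuasiGroundUnion R S) {K : Set (L.Term V)}
    (hK : ∀ a ∈ K, ∀ b, Rewrite (R ∪ S).rules a b → aliens R.sig S.sig b ⊆ K)
    (hs : aliens R.sig S.sig s ⊆ K) (h : Rewrite (R ∪ S).rules s t) :
    aliens R.sig S.sig t ⊆ K := by
  obtain htop | halien := H.rewrite_top_or_alienRewrite h
  · exact (htop.vars_subset fun _ => TRS.vars_rhs_subset).trans hs
  · exact halien.aliens_subset hK hs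

theorem aliens_subset_of_hereditary (H : QuasiGroundUnion R S) {K : Set (L.Term V)}
    (hK : Hereditary (R ∪ S).rules K) (hs : aliens R.sig S.sig s ⊆ K)
    (h : Rewrite (R ∪ S).rules s t) : aliens R.sig S.sig t ⊆ K :=
  H.aliens_subset_of_rewrite (fun a ha b hab => hK.aliens_subset (hK.rewrite_mem a ha b hab)) hs h

section ConfluentAliens

variable {N : Set (L.Term V)}

theorem reduces_classTerm (H : QuasiGroundUnion R S)
    (hconf : ∀ a ∈ N, ConfluentAt (Rewrite (R ∪ S).rules) a)
    (halien : ∀ a ∈ N, Alien R.sig S.sig a)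
    (hN : ∀ a ∈ N, ∀ b, Rewrite (R ∪ S).rules a b → b ∈ N)
    (hs : aliens R.sig S.sig s ⊆ N) (h : Reduces (R ∪ S).rules s t) :
    aliens R.sig S.sig t ⊆ N ∧
      Reduces R.rules (classTerm R.sig S.sig (R ∪ S).rules s)
        (classTerm R.sig S.sig (R ∪ S).rules t) := by
  induction h with
  | refl => exact ⟨hs, .refl⟩
  | tail _ hstep ih =>
    obtain ⟨haliens, hred⟩ := ih
    refine ⟨H.aliens_subset_of_rewrite (fun a ha b hab => ?_) haliens hstep, ?_⟩
    · rw [aliens_of_alien (halien b (hN a ha b hab))]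
      exact Set.singleton_subset_iff.2 (hN a ha b hab)
    obtain htop | hbelow := H.rewrite_top_or_alienRewrite hstep
    · exact hred.tail (htop.subst _)
    · rwa [← hbelow.classTerm_eq hconf (fun a ha b hab => halien b (hN a ha b hab)) haliens]

theorem confluentAt_of_stable_aliens [Infinite V] (H : QuasiGroundUnion R S) (hR : R.Confluent)
    (hconf : ∀ a ∈ N, ConfluentAt (Rewrite (R ∪ S).rules) a)
    (halien : ∀ a ∈ N, Alien R.sig S.sig a)
    (hN : ∀ a ∈ N, ∀ b, Rewrite (R ∪ S).rules a b → b ∈ N)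
    (hs : aliens R.sig S.sig s ⊆ N) : ConfluentAt (Rewrite (R ∪ S).rules) s := by
  intro t u hst hsu
  obtain ⟨htN, hst⟩ := H.reduces_classTerm hconf halien hN hs hst
  obtain ⟨huN, hsu⟩ := H.reduces_classTerm hconf halien hN hs hsu
  obtain ⟨w, htw, huw⟩ := hR.confluentAt
    (subst_mem_termsOver (isLayer_top s).1 fun _ _ => Set.empty_subset _) hst hsu
  have : Nonempty (L.Term V) := ⟨s⟩
  obtain ⟨g, hg⟩ := exists_common_reduct_of_joinClass
    ((vars_finite (top R.sig S.sig t)).union (vars_finite (top R.sig S.sig u)))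
    fun a ha => hconf a (Set.union_subset htN huN ha)
  have hpull {q : L.Term V} (hq : aliens R.sig S.sig q ⊆ aliens R.sig S.sig t ∪
      aliens R.sig S.sig u)
      (hqw : Reduces R.rules (classTerm R.sig S.sig (R ∪ S).rules q) w) :
      Reduces (R ∪ S).rules q (w.subst g) := by
    have hq_class : Reduces (R ∪ S).rules q
        ((classTerm R.sig S.sig (R ∪ S).rules q).subst g) := by
      rw [classTerm, subst_subst]
      exact reduces_top_subst fun a ha => hg a (hq ha)
    exact hq_class.trans (Reduces.mono Set.subset_union_left (Reduces.subst hqw g))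
  exact ⟨w.subst g, hpull Set.subset_union_left htw, hpull Set.subset_union_right huw⟩

end ConfluentAliens

/-- Rewriting the maximal aliens of `s` to representatives with preserved aliens gives a reduct of
`s` to which `confluentAt_of_stable_aliens` applies, even though the aliens of `s` itself may
collapse. -/
theorem confluentAt_of_aliens_subset [Infinite V] (H : QuasiGroundUnion R S) (hR : R.Confluent)
    {K : Set (L.Term V)} (hK : Hereditary (R ∪ S).rules K)
    (hconf : ∀ a ∈ K, ConfluentAt (Rewrite (R ∪ S).rules) a)
    (hpres : HasInnerPreservedReducts R.sig S.sig (R ∪ S).rules K)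
    (hs : aliens R.sig S.sig s ⊆ K) : ConfluentAt (Rewrite (R ∪ S).rules) s := by
  have : Nonempty (L.Term V) := ⟨s⟩
  choose! rep hrep using hpres
  have hreduces : ∀ s ∈ {s | aliens R.sig S.sig s ⊆ K},
      Reduces (R ∪ S).rules s ((top R.sig S.sig s).subst rep) := fun s hs =>
    reduces_top_subst fun a ha => (hrep a (hs ha)).1
  refine confluentAt_of_reduct_map (T := {s | aliens R.sig S.sig s ⊆ K})
    (fun s hs t => H.aliens_subset_of_hereditary hK hs)
    hreduces (fun s hs => ?_) (fun s hs t hst => ?_) hs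
  · refine H.confluentAt_of_stable_aliens hR
      (N := K ∩ preservedAliens R.sig S.sig (R ∪ S).rules) (fun a ha => hconf a ha.1)
      (fun a ha => ha.2 a .refl) (fun a ha b hab =>
        ⟨hK.rewrite_mem a ha.1 b hab, mem_preservedAliens_of_rewrite ha.2 hab⟩) ?_
    rw [aliens_subst (isLayer_top s)]
    refine Set.iUnion₂_subset fun a ha => Set.subset_inter ?_ (hrep a (hs ha)).2
    exact hK.aliens_subset (mem_of_reflTransGen hK.rewrite_mem (hs ha) (hrep a (hs ha)).1)
  · obtain htop | ⟨E, a, b, ha, hab, hsE, htE⟩ := H.rewrite_top_or_alienRewrite hst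
    · exact ⟨_, .single ((htop.subst rep).mono Set.subset_union_left), .refl⟩
    rw [hsE, htE, subst_subst, subst_subst]
    refine join_subst E ?_
    rintro (_ | c) -
    · have hb : aliens R.sig S.sig b ⊆ K := hK.aliens_subset (hK.rewrite_mem a (hs ha) b hab)
      exact hconf a (hs ha) (hrep a (hs ha)).1 ((hreduces b hb).head hab)
    · exact ⟨rep c, .refl, .refl⟩

section Rank

variable {K : Set (L.Term V)}

theorem hereditary_addLayer (H : QuasiGroundUnion R S) (hK : Hereditary (R ∪ S).rules K) :
    Hereditary (R ∪ S).rules {t | AddLayer R.sig S.sig K t} where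
  arg_mem := by
    rintro n f ts (h | h | ⟨-, h⟩) i
    · exact .left (hK.aliens_arg_subset h i)
    · exact .right (hK.aliens_arg_subset h i)
    · exact .left (hK.aliens_subset (h i))
  rewrite_mem := by
    rintro a (h | h | @⟨n, f, ts, hf, h⟩) b hab
    · exact .left (H.aliens_subset_of_hereditary hK h hab)
    · rw [TRS.union_comm] at hK hab
      exact .right (H.symm.aliens_subset_of_hereditary hK h hab)
    · obtain ⟨i, u, hu, rfl⟩ :=
        hab.exists_arg (fun _ => TRS.lhs_ne_var) H.not_rootIn_shared hf
      exact .shared hf ((forall_update_iff ts fun _ q => q ∈ K).2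
        ⟨hK.rewrite_mem _ (h i) u hu, fun j _ => h j⟩)

theorem hereditary_rankLE (H : QuasiGroundUnion R S) (k : ℕ) :
    Hereditary (R ∪ S).rules (rankLE V R.sig S.sig k) := by
  induction k with
  | zero =>
    constructor
    · rintro _ _ _ ⟨x, hx⟩
      cases hx
    · rintro _ ⟨x, rfl⟩ b hb
      exact absurd hb (not_rewrite_var fun _ => TRS.lhs_ne_var)
  | succ k ih => exact H.hereditary_addLayer ih

theorem hasInnerPreservedReducts_addLayer (H : QuasiGroundUnion R S)
    (hK : Hereditary (R ∪ S).rules K)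
    (hpres : HasInnerPreservedReducts R.sig S.sig (R ∪ S).rules K) :
    HasInnerPreservedReducts R.sig S.sig (R ∪ S).rules {t | AddLayer R.sig S.sig K t} := by
  intro t ht
  by_cases hmem : t ∈ preservedAliens R.sig S.sig (R ∪ S).rules
  · refine ⟨t, .refl, ?_⟩
    rw [aliens_of_alien (hmem t .refl)]
    exact Set.singleton_subset_iff.2 hmem
  obtain ⟨b, htb, hb⟩ : ∃ b, Reduces (R ∪ S).rules t b ∧ ¬Alien R.sig S.sig b := by
    simpa only [preservedAliens, Set.mem_ofPred_eq, not_forall, exists_prop] using hmem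
  obtain h | h | @⟨n, f, ts, hf, h⟩ := ht
  · have : Nonempty (L.Term V) := ⟨t⟩
    choose! rep hrep using hpres
    refine ⟨_, reduces_top_subst fun a ha => (hrep a (h ha)).1, ?_⟩
    rw [aliens_subst (isLayer_top t)]
    exact Set.iUnion₂_subset fun a ha => (hrep a (h ha)).2
  · have hbK : aliens S.sig R.sig b ⊆ K := by
      refine mem_of_reflTransGen (T := {q | aliens S.sig R.sig q ⊆ K}) (fun s hs t hst => ?_) h htb
      rw [TRS.union_comm] at hK hst
      exact H.symm.aliens_subset_of_hereditary hK hs hst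
    by_cases hb' : Alien S.sig R.sig b
    · rw [aliens_of_alien hb'] at hbK
      obtain ⟨c, hbc, hc⟩ := hpres b (hbK rfl)
      exact ⟨c, htb.trans hbc, hc⟩
    · refine ⟨b, htb, ?_⟩
      rw [aliens_eq_empty (mem_groundTerms_of_not_alien hb hb')]
      exact Set.empty_subset _
  · obtain ⟨us, rfl, -⟩ := Reduces.exists_args (fun _ => TRS.lhs_ne_var) H.not_rootIn_shared hf htb
    refine ⟨_, htb, ?_⟩
    rw [aliens_eq_empty ((not_alien_func_iff.1 hb).2 hf.2)]
    exact Set.empty_subset _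

theorem hasInnerPreservedReducts_rankLE (H : QuasiGroundUnion R S) (k : ℕ) :
    HasInnerPreservedReducts R.sig S.sig (R ∪ S).rules (rankLE V R.sig S.sig k) := by
  induction k with
  | zero =>
    rintro _ ⟨x, rfl⟩
    refine ⟨.var x, .refl, ?_⟩
    rintro _ rfl b hb
    rw [(reduces_var_iff fun _ => TRS.lhs_ne_var).1 hb]
    exact False.elim
  | succ k ih => exact H.hasInnerPreservedReducts_addLayer (H.hereditary_rankLE k) ih

theorem confluentAt_of_mem_rankLE [Infinite V] (H : QuasiGroundUnion R S) (hR : R.Confluent)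
    (hS : S.Confluent) {k : ℕ} (hs : s ∈ rankLE V R.sig S.sig k) :
    ConfluentAt (Rewrite (R ∪ S).rules) s := by
  induction k generalizing s with
  | zero =>
    obtain ⟨x, rfl⟩ := hs
    intro t u ht hu
    obtain rfl := (reduces_var_iff fun _ => TRS.lhs_ne_var).1 ht
    obtain rfl := (reduces_var_iff fun _ => TRS.lhs_ne_var).1 hu
    exact ⟨.var x, .refl, .refl⟩
  | succ k ih =>
    obtain h | h | ⟨hf, h⟩ := hs
    · exact H.confluentAt_of_aliens_subset hR (H.hereditary_rankLE k) (fun _ => ih)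
        (H.hasInnerPreservedReducts_rankLE k) h
    · rw [rankLE_comm] at h ih
      rw [TRS.union_comm] at ih ⊢
      exact H.symm.confluentAt_of_aliens_subset hS (H.symm.hereditary_rankLE k) (fun _ => ih)
        (H.symm.hasInnerPreservedReducts_rankLE k) h
    · exact confluentAt_func (fun _ => TRS.lhs_ne_var) H.not_rootIn_shared hf fun i => ih (h i)

theorem exists_mem_rankLE (H : QuasiGroundUnion R S) (hs : s ∈ termsOver V (R ∪ S).sig) :
    ∃ k, s ∈ rankLE V R.sig S.sig k := by
  have hmono : Monotone (rankLE V R.sig S.sig) :=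
    monotone_nat_of_le_succ fun k t ht => .left ((H.hereditary_rankLE k).aliens_subset ht)
  induction s with
  | var x => exact ⟨0, x, rfl⟩
  | func f ts ih =>
    obtain ⟨hf, hts⟩ := func_mem_termsOver_iff.1 hs
    choose k hk using fun i => ih i (hts i)
    obtain ⟨m, hm⟩ := Finite.bddAbove_range k
    have hargs (i) : ts i ∈ rankLE V R.sig S.sig m := hmono (hm ⟨i, rfl⟩) (hk i)
    have haliens {F G : Set (Symbol L)} (h : ¬Alien F G (.func f ts)) :
        aliens F G (.func f ts) ⊆ rankLE V R.sig S.sig m := by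
      rw [aliens_func h]
      exact Set.iUnion_subset fun i => (H.hereditary_rankLE m).aliens_subset (hargs i)
    refine ⟨m + 1, ?_⟩
    by_cases hR : ⟨_, f⟩ ∈ R.sig <;> by_cases hS : ⟨_, f⟩ ∈ S.sig
    · exact .shared ⟨hR, hS⟩ hargs
    · exact .left (haliens (not_alien_func_iff.2 ⟨hR, fun hS' => absurd hS' hS⟩))
    · exact .right (haliens (not_alien_func_iff.2 ⟨hS, fun hR' => absurd hR' hR⟩))
    · exact (hf.elim hR hS).elim

end Rank

end QuasiGroundUnion

end Rewriting

theorem mainTheorem8_general {L : FirstOrder.Language} {V : Type*} [Infinite V]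
    (R₁ R₂ : Rewriting.TRS L V)
    (hroot : ∀ ρ ∈ (R₁ ∪ R₂).rules, ¬ Rewriting.RootIn (R₁.sig ∩ R₂.sig) ρ.1)
    (hqg : ∀ ρ ∈ (R₁ ∪ R₂).rules,
      Rewriting.QuasiGround R₁.sig R₂.sig ρ.1 ∧ Rewriting.QuasiGround R₁.sig R₂.sig ρ.2)
    (h₁ : R₁.Confluent) (h₂ : R₂.Confluent) :
    (R₁ ∪ R₂).Confluent := by
  have H : Rewriting.QuasiGroundUnion R₁ R₂ := ⟨hroot, hqg⟩
  refine Rewriting.TRS.confluent_iff.2 fun s hs => ?_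
  obtain ⟨k, hk⟩ := H.exists_mem_rankLE hs
  exact H.confluentAt_of_mem_rankLE h₁ h₂ hk

theorem mainTheorem8 {L : FirstOrder.Language} {V : Type*} [Countable V] [Infinite V]
    (R₁ R₂ : Rewriting.TRS L V)
    (hroot : ∀ ρ ∈ (R₁ ∪ R₂).rules, ¬ Rewriting.RootIn (R₁.sig ∩ R₂.sig) ρ.1)
    (hqg : ∀ ρ ∈ (R₁ ∪ R₂).rules,
      Rewriting.QuasiGround R₁.sig R₂.sig ρ.1 ∧ Rewriting.QuasiGround R₁.sig R₂.sig ρ.2)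
    (h₁ : R₁.Confluent) (h₂ : R₂.Confluent) :
    (R₁ ∪ R₂).Confluent :=
  mainTheorem8_general R₁ R₂ hroot hqg h₁ h₂
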